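/- For a connected finite simple graph $G$ with vertex set $V$, let $d_G(u,v)$ be the distance and $e_G(u)=\max_v d_G(u,v)$ the eccentricity. The eccentricity matrix $\mathcal{E}(G)$ is the real symmetric $V\times V$ matrix with $\mathcal{E}(G)_{uv}=d_G(u,v)$ if $d_G(u,v)=\min\{e_G(u),e_G(v)\}$ and $\mathcal{E}(G)_{uv}=0$ otherwise. Let $\xi_2(G)$ be the second largest eigenvalue of $\mathcal{E}(G)$ (eigenvalues listed in non-increasing order with multiplicity). For $n\ge 4$ let $T_{n,3}^{0,n-4}$ be the tree on $n$ vertices obtained from the path $v_0v_1v_2v_3$ by attaching $n-4$ pendant vertices to $v_2$. **Theorem.** Let $T$ be a tree of order $n\geq 4$ whose complement $T^c$ is connected (equivalently, $T$ is not a star). Then $$\xi_2(T)+\xi_2(T^c)\;\geq\;\sqrt{\frac{13n-35-\sqrt{169n^2-974n+1417}}{2}}+\sqrt{\frac{4n+1-\sqrt{16n^2-56n+193}}{2}},$$ with equality if and only if $T\cong T_{n,3}^{0,n-4}$. -/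

import Mathlib

noncomputable section

namespace EccGraph

/-- The eccentricity matrix of a finite graph: the entry at `(u, v)` is the distance `d(u, v)` if
`d(u, v) = min {e(u), e(v)}`, where `e` denotes the eccentricity of a vertex, and `0` otherwise. -/
def eccMatrix {V : Type*} (G : SimpleGraph V) : Matrix V V ℝ := by
  classical
  exact Matrix.of fun u v =>
    if G.edist u v = min (G.eccent u) (G.eccent v) then (G.dist u v : ℝ) else 0

theorem eccMatrix_isHermitian {V : Type*} (G : SimpleGraph V) : (eccMatrix G).IsHermitian := by
  ext u v
  simp only [eccMatrix, Matrix.conjTranspose_apply, Matrix.of_apply, star_trivial]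
  rw [SimpleGraph.edist_comm, SimpleGraph.dist_comm, min_comm]

/-- The second largest eigenvalue (counted with multiplicity) of the eccentricity matrix of a graph
with at least two vertices; `Matrix.IsHermitian.eigenvalues₀` lists all eigenvalues in
non-increasing order, with indices starting at `0`. -/
def xi2 {V : Type*} [Fintype V] (G : SimpleGraph V) (hV : 2 ≤ Fintype.card V) : ℝ := by
  classical
  exact (eccMatrix_isHermitian G).eigenvalues₀ ⟨1, hV⟩

/-- The tree obtained from the path `v₀ v₁ v₂ v₃` (the four vertices `Sum.inl i`) by attaching `a`
pendant vertices to `v₁` and `b` pendant vertices to `v₂`; it has `n = a + b + 4` vertices. -/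
def treeT3 (a b : ℕ) : SimpleGraph (Fin 4 ⊕ (Fin a ⊕ Fin b)) :=
  SimpleGraph.fromRel fun x y =>
    match x, y with
    | Sum.inl i, Sum.inl j => (i : ℕ) + 1 = (j : ℕ)
    | Sum.inl i, Sum.inr (Sum.inl _) => i = 1
    | Sum.inl i, Sum.inr (Sum.inr _) => i = 2
    | _, _ => False

end EccGraph

end

/-! A tree whose complement is connected has diameter at least 3, and the ends `u`, `v` of a longest
path are leaves, with neighbours `u'`, `v'`.

If the diameter is at least 4, only the 4×4 principal submatrices on `u, u', v', v` are used. Two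
test vectors in each give `ξ₂(T) ≥ 4/3` and `ξ₂(Tᶜ) ≥ 2` (`xi2_ge_of_four_le_diam`,
`xi2_compl_ge_of_four_le_diam`), while the two terms of the bound are strictly below 4/3 and 2.

If the diameter is 3, `T` is a double star with `p` and `q` leaves at its centers, `p + q = n - 2`.
Both eccentricity matrices are blow-ups of the same path with edge weights 2, 3, 2, with cell sizes
`1, q, p, 1` for `T` and `p, 1, 1, q` for `Tᶜ`. The squares of the nonzero eigenvalues of such a
blow-up are the roots of `x² - S x + D`, so `ξ₂²` is the smaller root
(`eigenvalues₀_one_submatrix`), where `D = 16pq` in both cases and `S` is `4(n-2) + 9pq` for `T` and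
`4(n-2) + 9` for `Tᶜ`. Both smaller roots increase strictly with `pq`, and `pq` is least, namely `n
- 3`, exactly when one center has a single leaf. That is the extremal tree. -/

namespace EccGraph
open Matrix SimpleGraph

/-! ### The second largest eigenvalue: lower bounds from eigenvectors and from test vectors. -/

section Eigenvalues

variable {V : Type*} [Fintype V] [DecidableEq V] {A : Matrix V V ℝ}

theorem eigenvalues_equivOfCardEq (hA : A.IsHermitian) (i : Fin (Fintype.card V)) :
    hA.eigenvalues (Fintype.equivOfCardEq (Fintype.card_fin _) i) = hA.eigenvalues₀ i := by
  simp [Matrix.IsHermitian.eigenvalues]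

theorem exists_eigenvalues_eq (hA : A.IsHermitian) {x : V → ℝ} (hx : x ≠ 0) {μ : ℝ}
    (h : A *ᵥ x = μ • x) : ∃ i, hA.eigenvalues₀ i = μ := by
  have h1 : Module.End.HasEigenvalue (Matrix.toLin' A) μ :=
    Module.End.hasEigenvalue_of_hasEigenvector
      (Module.End.hasEigenvector_iff.mpr
        ⟨Module.End.mem_eigenspace_iff.mpr (by simpa using h), hx⟩)
  have h2 := h1.mem_spectrum
  rw [Matrix.spectrum_toLin', hA.spectrum_real_eq_range_eigenvalues] at h2
  obtain ⟨i, hi⟩ := h2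
  exact ⟨_, hi⟩

/-- Two different eigenvalues `μ < ν` force the second largest eigenvalue to be at least `μ`. -/
theorem le_eigenvalues₀_one_of_eigenvectors (hA : A.IsHermitian) (hV : 1 < Fintype.card V)
    {x y : V → ℝ} (hx : x ≠ 0) (hy : y ≠ 0) {μ ν : ℝ} (hμν : μ < ν)
    (h : A *ᵥ x = μ • x) (h' : A *ᵥ y = ν • y) : μ ≤ hA.eigenvalues₀ ⟨1, hV⟩ := by
  obtain ⟨i, rfl⟩ := exists_eigenvalues_eq hA hx h
  obtain ⟨j, rfl⟩ := exists_eigenvalues_eq hA hy h'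
  have hij : j < i := by
    by_contra hc
    exact absurd (hA.eigenvalues₀_antitone (not_lt.mp hc)) (not_le.mpr hμν)
  refine hA.eigenvalues₀_antitone ?_
  rw [Fin.le_def]
  have := Fin.lt_def.mp hij
  simp only
  omega

/-- Orthogonal eigenvectors for the two largest eigenvalues. -/
theorem exists_orthogonal_eigenvectors (hA : A.IsHermitian) (hV : 1 < Fintype.card V) :
    ∃ x y : V → ℝ, x ⬝ᵥ y = 0 ∧ x ≠ 0 ∧ y ≠ 0 ∧
      A *ᵥ x = hA.eigenvalues₀ ⟨0, by omega⟩ • x ∧ A *ᵥ y = hA.eigenvalues₀ ⟨1, hV⟩ • y := by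
  set e := Fintype.equivOfCardEq (α := Fin (Fintype.card V)) (β := V) (Fintype.card_fin _) with he
  have hne : e ⟨1, hV⟩ ≠ e ⟨0, by omega⟩ := fun h => by simpa using e.injective h
  refine ⟨hA.eigenvectorBasis (e ⟨0, by omega⟩), hA.eigenvectorBasis (e ⟨1, hV⟩), ?_, ?_, ?_,
    ?_, ?_⟩
  · have : inner ℝ _ _ = 0 := hA.eigenvectorBasis.orthonormal.2 hne
    rw [EuclideanSpace.inner_eq_star_dotProduct, star_trivial] at this
    exact this
  · intro h
    exact hA.eigenvectorBasis.orthonormal.ne_zero (e ⟨0, by omega⟩) (by ext v; exact congrFun h v)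
  · intro h
    exact hA.eigenvectorBasis.orthonormal.ne_zero (e ⟨1, hV⟩) (by ext v; exact congrFun h v)
  · rw [← eigenvalues_equivOfCardEq]; exact hA.mulVec_eigenvectorBasis _
  · rw [← eigenvalues_equivOfCardEq]; exact hA.mulVec_eigenvectorBasis _

theorem dotProduct_eq_sum_eigenvectorBasis (hA : A.IsHermitian) (w z : V → ℝ) :
    w ⬝ᵥ z = ∑ i, (w ⬝ᵥ hA.eigenvectorBasis i) * (z ⬝ᵥ hA.eigenvectorBasis i) := by
  have := hA.eigenvectorBasis.sum_inner_mul_inner (WithLp.toLp 2 w) (WithLp.toLp 2 z)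
  simp only [EuclideanSpace.inner_eq_star_dotProduct, star_trivial] at this
  rw [dotProduct_comm, ← this]
  refine Finset.sum_congr rfl fun i _ => ?_
  rw [dotProduct_comm w]

theorem dotProduct_mulVec_eq_sum_eigenvalues (hA : A.IsHermitian) (w : V → ℝ) :
    w ⬝ᵥ A *ᵥ w = ∑ i, hA.eigenvalues i * (w ⬝ᵥ hA.eigenvectorBasis i) ^ 2 := by
  rw [dotProduct_eq_sum_eigenvectorBasis hA]
  refine Finset.sum_congr rfl fun i _ => ?_
  have hs : Aᵀ = A := by simpa using hA.eq
  have : (A *ᵥ w) ⬝ᵥ hA.eigenvectorBasis i = hA.eigenvalues i * (w ⬝ᵥ hA.eigenvectorBasis i) := by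
    rw [dotProduct_comm, dotProduct_mulVec, ← mulVec_transpose, hs, hA.mulVec_eigenvectorBasis,
      smul_dotProduct, smul_eq_mul, dotProduct_comm]
  rw [this]; ring

/-- Rayleigh bound from a two-dimensional test space with an orthogonal basis that also
diagonalizes the quadratic form. -/
theorem le_eigenvalues₀_one_of_test_vectors (hA : A.IsHermitian) (hV : 1 < Fintype.card V)
    {x y : V → ℝ} {c : ℝ} (hx : 0 < x ⬝ᵥ x) (hy : 0 < y ⬝ᵥ y) (hxy : x ⬝ᵥ y = 0)
    (hAxy : x ⬝ᵥ A *ᵥ y = 0) (hQx : c * (x ⬝ᵥ x) ≤ x ⬝ᵥ A *ᵥ x)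
    (hQy : c * (y ⬝ᵥ y) ≤ y ⬝ᵥ A *ᵥ y) : c ≤ hA.eigenvalues₀ ⟨1, hV⟩ := by
  set e := Fintype.equivOfCardEq (α := Fin (Fintype.card V)) (β := V) (Fintype.card_fin _) with he
  set i₀ := e ⟨0, by omega⟩ with hi₀
  have hs : Aᵀ = A := by simpa using hA.eq
  have hAyx : y ⬝ᵥ A *ᵥ x = 0 := by
    rw [dotProduct_mulVec, ← mulVec_transpose, hs, dotProduct_comm]; exact hAxy
  -- A plane always meets the orthogonal complement of the top eigenvector. There the Rayleigh
  -- quotient is at most the second eigenvalue, while on the whole plane it is at least `c`.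
  obtain ⟨α, β, hαβ, horth⟩ : ∃ α β : ℝ, (0 < α ^ 2 ∨ 0 < β ^ 2) ∧
      (α • x + β • y) ⬝ᵥ hA.eigenvectorBasis i₀ = 0 := by
    by_cases h : x ⬝ᵥ hA.eigenvectorBasis i₀ = 0
    · exact ⟨1, 0, by norm_num, by simpa using h⟩
    · refine ⟨-(y ⬝ᵥ hA.eigenvectorBasis i₀), x ⬝ᵥ hA.eigenvectorBasis i₀, Or.inr (by positivity), ?_⟩
      simp only [add_dotProduct, smul_dotProduct, smul_eq_mul]
      ring
  set w := α • x + β • y with hw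
  have hyx : y ⬝ᵥ x = 0 := by rw [dotProduct_comm]; exact hxy
  have hww : w ⬝ᵥ w = α ^ 2 * (x ⬝ᵥ x) + β ^ 2 * (y ⬝ᵥ y) := by
    simp only [hw, add_dotProduct, dotProduct_add, smul_dotProduct, dotProduct_smul, smul_eq_mul,
      hxy, hyx]
    ring
  have hAww : w ⬝ᵥ A *ᵥ w = α ^ 2 * (x ⬝ᵥ A *ᵥ x) + β ^ 2 * (y ⬝ᵥ A *ᵥ y) := by
    simp only [hw, mulVec_add, mulVec_smul, add_dotProduct, dotProduct_add, smul_dotProduct,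
      dotProduct_smul, smul_eq_mul, hAxy, hAyx]
    ring
  have hpos : 0 < w ⬝ᵥ w := by
    rw [hww]
    rcases hαβ with h | h
    · have := mul_pos h hx
      have := mul_nonneg (sq_nonneg β) hy.le
      linarith
    · have := mul_pos h hy
      have := mul_nonneg (sq_nonneg α) hx.le
      linarith
  have hlow : c * (w ⬝ᵥ w) ≤ w ⬝ᵥ A *ᵥ w := by
    rw [hww, hAww]
    have := mul_le_mul_of_nonneg_left hQx (sq_nonneg α)
    have := mul_le_mul_of_nonneg_left hQy (sq_nonneg β)
    linarith
  have hup : w ⬝ᵥ A *ᵥ w ≤ hA.eigenvalues₀ ⟨1, hV⟩ * (w ⬝ᵥ w) := by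
    rw [dotProduct_mulVec_eq_sum_eigenvalues hA, dotProduct_eq_sum_eigenvectorBasis hA w w,
      Finset.mul_sum]
    refine Finset.sum_le_sum fun i _ => ?_
    by_cases hi : i = i₀
    · rw [hi, horth]; simp
    · rw [← sq]
      refine mul_le_mul_of_nonneg_right (hA.eigenvalues₀_antitone ?_) (sq_nonneg _)
      rw [Fin.le_def]
      simp only
      rw [Nat.one_le_iff_ne_zero]
      intro h0
      apply hi
      rw [hi₀, ← Equiv.symm_apply_eq]
      exact Fin.ext h0
  exact le_of_mul_le_mul_right (hlow.trans hup) hpos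

end Eigenvalues

/-! ### Spectrum of blow-ups of the weighted path. -/

section WeightedPath

/-- The weighted adjacency matrix of the path on four vertices with edge weights `2, 3, 2`. -/
def pathWeight : Matrix (Fin 4) (Fin 4) ℝ :=
  !![0, 2, 0, 0; 2, 0, 3, 0; 0, 3, 0, 2; 0, 0, 2, 0]

variable {V : Type*} [Fintype V]

theorem submatrix_mulVec_apply {ι : Type*} [Fintype ι] [DecidableEq ι] (W : Matrix ι ι ℝ)
    (κ : V → ι) (z : V → ℝ) (v : V) :
    (W.submatrix κ κ *ᵥ z) v = (W *ᵥ fun j => ∑ u with κ u = j, z u) (κ v) := by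
  simp only [mulVec, dotProduct, submatrix_apply]
  rw [← Finset.sum_fiberwise Finset.univ κ]
  refine Finset.sum_congr rfl fun j _ => ?_
  rw [Finset.mul_sum]
  refine Finset.sum_congr rfl fun u hu => ?_
  rw [(Finset.mem_filter.mp hu).2]

theorem sum_fiber_comp {ι : Type*} [DecidableEq ι] (κ : V → ι) (f : ι → ℝ) (j : ι) :
    ∑ u with κ u = j, f (κ u) = (Finset.card {u | κ u = j} : ℝ) * f j := by
  rw [Finset.sum_congr rfl fun u hu => by rw [(Finset.mem_filter.mp hu).2], Finset.sum_const,
    nsmul_eq_mul]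

theorem sum_comp_eq_sum_fiber {ι : Type*} [Fintype ι] [DecidableEq ι] (κ : V → ι) (f : ι → ℝ) :
    ∑ u, f (κ u) = ∑ j, (Finset.card {u | κ u = j} : ℝ) * f j := by
  rw [← Finset.sum_fiberwise Finset.univ κ]
  exact Finset.sum_congr rfl fun j _ => sum_fiber_comp κ f j

variable {κ : V → Fin 4} {m : Fin 4 → ℝ}

theorem submatrix_mulVec_comp (hm : ∀ i, (Finset.card {u | κ u = i} : ℝ) = m i) (f : Fin 4 → ℝ) :
    pathWeight.submatrix κ κ *ᵥ (f ∘ κ) = (pathWeight *ᵥ (m * f)) ∘ κ := by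
  ext v
  rw [submatrix_mulVec_apply]
  simp only [Function.comp_apply, sum_fiber_comp, hm]
  rfl

/-- Every positive root of the characteristic equation of the quotient is an eigenvalue. -/
theorem exists_eigenvector_submatrix (hm : ∀ i, (Finset.card {u | κ u = i} : ℝ) = m i)
    (hpos : ∀ i, 0 < m i) {t : ℝ} (ht : 0 < t)
    (h : (t ^ 2 - 4 * m 0 * m 1) * (t ^ 2 - 4 * m 2 * m 3) = 9 * t ^ 2 * m 1 * m 2) :
    ∃ x : V → ℝ, x ≠ 0 ∧ pathWeight.submatrix κ κ *ᵥ x = t • x := by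
  -- Solve the quotient system starting from `f 1 = 3 * t * m 2`. Rows 0, 1 and 3 determine the
  -- other entries, and row 2 is then the characteristic equation.
  let f : Fin 4 → ℝ := ![6 * m 1 * m 2, 3 * t * m 2, t ^ 2 - 4 * m 0 * m 1,
    2 * m 2 * (t ^ 2 - 4 * m 0 * m 1) / t]
  refine ⟨f ∘ κ, ?_, ?_⟩
  · intro h0
    have hne : (Finset.univ.filter fun u => κ u = 1).Nonempty := by
      rw [← Finset.card_pos]
      have := hpos 1
      rw [← hm 1] at this
      exact_mod_cast this
    obtain ⟨u, hu⟩ := hne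
    have h1 := congrFun h0 u
    rw [Function.comp_apply, (Finset.mem_filter.mp hu).2] at h1
    have := mul_pos ht (hpos 2)
    simp [f] at h1
    rcases h1 with h1 | h1
    · exact ht.ne' h1
    · exact (hpos 2).ne' h1
  · rw [submatrix_mulVec_comp hm]
    have : pathWeight *ᵥ (m * f) = t • f := by
      ext i
      fin_cases i <;>
        simp [pathWeight, mulVec, dotProduct, Fin.sum_univ_four, f]
      · ring
      · ring
      · field_simp
        linear_combination -h
      · field_simp
    rw [this]
    rfl

/-- Eigenvectors for nonzero eigenvalues are constant on cells. -/
theorem eigenvector_submatrix_eq_comp (hm : ∀ i, (Finset.card {u | κ u = i} : ℝ) = m i)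
    (hpos : ∀ i, 0 < m i) {t : ℝ} (ht : 0 < t) {x : V → ℝ} (hx : x ≠ 0)
    (h : pathWeight.submatrix κ κ *ᵥ x = t • x) :
    ∃ f : Fin 4 → ℝ, x = f ∘ κ ∧ f 2 ≠ 0 ∧
      t * f 0 = 2 * m 1 * f 1 ∧ (t ^ 2 - 4 * m 0 * m 1) * f 1 = 3 * t * m 2 * f 2 ∧
      (t ^ 2 - 4 * m 2 * m 3) * f 2 = 3 * t * m 1 * f 1 ∧ t * f 3 = 2 * m 2 * f 2 := by
  -- For `t ≠ 0` an eigenvector is its own image divided by `t`, and the image depends only on the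
  -- cell.
  let f : Fin 4 → ℝ := fun i => (pathWeight *ᵥ fun j => ∑ u with κ u = j, x u) i / t
  have hxf : x = f ∘ κ := by
    ext v
    have := congrFun h v
    rw [submatrix_mulVec_apply, Pi.smul_apply, smul_eq_mul] at this
    simp only [Function.comp_apply, f]
    rw [this]
    field_simp
  have hZ : (fun j => ∑ u with κ u = j, x u) = m * f := by
    ext j
    rw [hxf]
    simp only [Function.comp_apply, sum_fiber_comp, hm]
    rfl
  have hf : ∀ i, t * f i = (pathWeight *ᵥ (m * f)) i := by
    intro i
    rw [← hZ]
    simp only [f]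
    field_simp
  have h0 := hf 0
  have h1 := hf 1
  have h2 := hf 2
  have h3 := hf 3
  simp only [pathWeight, mulVec, dotProduct, Fin.sum_univ_four, Pi.mul_apply, of_apply, cons_val]
    at h0 h1 h2 h3
  -- Rows 0 and 3 eliminate the end values `f 0` and `f 3`, leaving a 2×2 system in `f 1` and `f 2`.
  have e1 : (t ^ 2 - 4 * m 0 * m 1) * f 1 = 3 * t * m 2 * f 2 := by
    linear_combination t * h1 + 2 * m 0 * h0
  have e2 : (t ^ 2 - 4 * m 2 * m 3) * f 2 = 3 * t * m 1 * f 1 := by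
    linear_combination t * h2 + 2 * m 3 * h3
  have e0 : t * f 0 = 2 * m 1 * f 1 := by linear_combination h0
  have e3 : t * f 3 = 2 * m 2 * f 2 := by linear_combination h3
  refine ⟨f, hxf, ?_, e0, e1, e2, e3⟩
  intro hf2
  have hf1 : f 1 = 0 := by
    rw [hf2, mul_zero] at e2
    have := mul_pos (mul_pos (by norm_num : (0 : ℝ) < 3) ht) (hpos 1)
    exact (mul_eq_zero.mp e2.symm).resolve_left this.ne'
  have hf0 : f 0 = 0 := by
    rw [hf1, mul_zero] at e0
    exact (mul_eq_zero.mp e0).resolve_left ht.ne'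
  have hf3 : f 3 = 0 := by
    rw [hf2, mul_zero] at e3
    exact (mul_eq_zero.mp e3).resolve_left ht.ne'
  apply hx
  rw [hxf]
  ext v
  have : ∀ i, f i = 0 := by
    intro i
    fin_cases i
    exacts [hf0, hf1, hf2, hf3]
  exact this _

theorem char_equation_of_eigenvector (hpos : ∀ i, 0 < m i) {t : ℝ} (ht : 0 < t)
    {f : Fin 4 → ℝ} (h2 : f 2 ≠ 0)
    (e1 : (t ^ 2 - 4 * m 0 * m 1) * f 1 = 3 * t * m 2 * f 2)
    (e2 : (t ^ 2 - 4 * m 2 * m 3) * f 2 = 3 * t * m 1 * f 1) :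
    (t ^ 2 - 4 * m 0 * m 1) * (t ^ 2 - 4 * m 2 * m 3) = 9 * t ^ 2 * m 1 * m 2 := by
  have h1 : f 1 ≠ 0 := by
    intro h1
    rw [h1, mul_zero] at e1
    have := mul_pos (mul_pos (by norm_num : (0 : ℝ) < 3) ht) (hpos 2)
    exact mul_ne_zero this.ne' h2 e1.symm
  apply mul_right_cancel₀ (mul_ne_zero h1 h2)
  linear_combination (t ^ 2 - 4 * m 2 * m 3) * f 2 * e1 + 3 * t * m 2 * f 2 * e2

/-- Each positive eigenvalue of a blow-up of the weighted path is simple. -/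
theorem dotProduct_ne_zero_of_eigenvectors (hm : ∀ i, (Finset.card {u | κ u = i} : ℝ) = m i)
    (hpos : ∀ i, 0 < m i) {t : ℝ} (ht : 0 < t) {x y : V → ℝ} (hx : x ≠ 0) (hy : y ≠ 0)
    (hAx : pathWeight.submatrix κ κ *ᵥ x = t • x) (hAy : pathWeight.submatrix κ κ *ᵥ y = t • y) :
    x ⬝ᵥ y ≠ 0 := by
  obtain ⟨f, rfl, hf2, hf0, hf1, hf1', hf3⟩ := eigenvector_submatrix_eq_comp hm hpos ht hx hAx
  obtain ⟨g, rfl, hg2, hg0, hg1, hg1', hg3⟩ := eigenvector_submatrix_eq_comp hm hpos ht hy hAy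
  set c := g 2 / f 2 with hc
  have c2 : g 2 = c * f 2 := by rw [hc]; field_simp
  have c1 : g 1 = c * f 1 := by
    have : 3 * t * m 1 ≠ 0 := (mul_pos (mul_pos (by norm_num) ht) (hpos 1)).ne'
    apply mul_left_cancel₀ this
    linear_combination -hg1' + c * hf1' + (t ^ 2 - 4 * m 2 * m 3) * c2
  have c0 : g 0 = c * f 0 := by
    apply mul_left_cancel₀ ht.ne'
    linear_combination hg0 - c * hf0 + 2 * m 1 * c1
  have c3 : g 3 = c * f 3 := by
    apply mul_left_cancel₀ ht.ne'
    linear_combination hg3 - c * hf3 + 2 * m 2 * c2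
  have hsum : (f ∘ κ) ⬝ᵥ (g ∘ κ) =
      c * (m 0 * f 0 ^ 2 + m 1 * f 1 ^ 2 + m 2 * f 2 ^ 2 + m 3 * f 3 ^ 2) := by
    have := sum_comp_eq_sum_fiber κ (f * g)
    simp only [Fin.sum_univ_four, hm, Pi.mul_apply] at this
    rw [dotProduct]
    simp only [Function.comp_apply]
    rw [this, c0, c1, c2, c3]
    ring
  rw [hsum]
  have hc0 : c ≠ 0 := div_ne_zero hg2 hf2
  have h0 := mul_nonneg (hpos 0).le (sq_nonneg (f 0))
  have h1 := mul_nonneg (hpos 1).le (sq_nonneg (f 1))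
  have h2 := mul_pos (hpos 2) (pow_pos (abs_pos.mpr hf2) 2)
  rw [sq_abs] at h2
  have h3 := mul_nonneg (hpos 3).le (sq_nonneg (f 3))
  exact mul_ne_zero hc0 (by linarith)

/-- The second largest eigenvalue of a blow-up of the weighted path is the smaller positive root
of the characteristic equation of the quotient. -/
theorem eigenvalues₀_one_submatrix [DecidableEq V] (hm : ∀ i, (Finset.card {u | κ u = i} : ℝ) = m i)
    (hpos : ∀ i, 0 < m i) {A : Matrix V V ℝ} (hAκ : A = pathWeight.submatrix κ κ)
    (hA : A.IsHermitian) (hV : 1 < Fintype.card V) {s : ℝ} (hs : 0 < s)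
    (h : (s ^ 2 - 4 * m 0 * m 1) * (s ^ 2 - 4 * m 2 * m 3) = 9 * s ^ 2 * m 1 * m 2)
    (hlt : 2 * s ^ 2 < 4 * m 0 * m 1 + 4 * m 2 * m 3 + 9 * m 1 * m 2) :
    hA.eigenvalues₀ ⟨1, hV⟩ = s := by
  subst hAκ
  set S := 4 * m 0 * m 1 + 4 * m 2 * m 3 + 9 * m 1 * m 2 with hS
  apply le_antisymm
  · by_contra hcon
    push Not at hcon
    obtain ⟨x, y, hxy, hx, hy, hAx, hAy⟩ := exists_orthogonal_eigenvectors hA hV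
    have hge : hA.eigenvalues₀ ⟨1, hV⟩ ≤ hA.eigenvalues₀ ⟨0, by omega⟩ :=
      hA.eigenvalues₀_antitone (by simp [Fin.le_def])
    set a := hA.eigenvalues₀ ⟨0, by omega⟩
    set b := hA.eigenvalues₀ ⟨1, hV⟩
    -- By Vieta, an eigenvalue above `s` must have the other root `S - s²` as its square. If the top
    -- two both exceed `s` they coincide, which contradicts simplicity.
    have key : ∀ {t : ℝ}, s < t → ∀ {z : V → ℝ}, z ≠ 0 →
        pathWeight.submatrix κ κ *ᵥ z = t • z → t ^ 2 = S - s ^ 2 := by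
      intro t hst z hz hAz
      have ht := hs.trans hst
      obtain ⟨f, -, h2, -, e1, e2, -⟩ := eigenvector_submatrix_eq_comp hm hpos ht hz hAz
      have hc := char_equation_of_eigenvector hpos ht h2 e1 e2
      have hne : t ^ 2 - s ^ 2 ≠ 0 := by
        have : s ^ 2 < t ^ 2 := by gcongr
        linarith
      apply mul_left_cancel₀ hne
      rw [hS]
      linear_combination hc - h
    have hab : a = b := by
      have h1 := key (hcon.trans_le hge) hx hAx
      have h2 := key hcon hy hAy
      exact (sq_eq_sq₀ (by linarith) (by linarith)).mp (h1.trans h2.symm)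
    rw [hab] at hAx
    exact dotProduct_ne_zero_of_eigenvectors hm hpos (hs.trans hcon) hx hy hAx hAy hxy
  · obtain ⟨x, hx, hAx⟩ := exists_eigenvector_submatrix hm hpos hs h
    -- The larger root also gives an eigenvalue, so `s` has a strictly larger eigenvalue above it.
    have hT : 0 < S - s ^ 2 := by nlinarith [sq_nonneg s]
    have hsq := Real.sq_sqrt hT.le
    have hτ : (Real.sqrt (S - s ^ 2) ^ 2 - 4 * m 0 * m 1) *
        (Real.sqrt (S - s ^ 2) ^ 2 - 4 * m 2 * m 3) =
        9 * Real.sqrt (S - s ^ 2) ^ 2 * m 1 * m 2 := by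
      rw [hsq, hS]
      linear_combination h
    obtain ⟨y, hy, hAy⟩ := exists_eigenvector_submatrix hm hpos (Real.sqrt_pos.mpr hT) hτ
    refine le_eigenvalues₀_one_of_eigenvectors hA hV hx hy ?_ hAx hAy
    exact Real.lt_sqrt_of_sq_lt (by linarith)

end WeightedPath

/-! ### Extension of test vectors by zero from a principal submatrix. -/

section TestVectors

variable {V ι : Type*} [Fintype V] [Fintype ι] {p : ι → V}

theorem extend_zero_dotProduct (hp : Function.Injective p) (f : ι → ℝ) (z : V → ℝ) :
    Function.extend p f 0 ⬝ᵥ z = f ⬝ᵥ (z ∘ p) := by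
  symm
  refine Fintype.sum_of_injective p hp _ _ (fun v hv => ?_) fun i => ?_
  · rw [Function.extend_apply' _ _ _ (by simpa using hv)]
    simp
  · rw [hp.extend_apply]
    rfl

theorem mulVec_extend_zero_comp (hp : Function.Injective p) (A : Matrix V V ℝ) (f : ι → ℝ) :
    (A *ᵥ Function.extend p f 0) ∘ p = A.submatrix p p *ᵥ f := by
  ext i
  simp only [Function.comp_apply, mulVec]
  rw [dotProduct_comm, extend_zero_dotProduct hp, dotProduct_comm]
  rfl

/-- Rayleigh bound from test vectors for a principal submatrix. -/
theorem le_eigenvalues₀_one_of_submatrix [DecidableEq V] {A : Matrix V V ℝ} (hA : A.IsHermitian)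
    (hV : 1 < Fintype.card V) (hp : Function.Injective p) {B : Matrix ι ι ℝ}
    (hB : A.submatrix p p = B) {x y : ι → ℝ} {c : ℝ} (hx : 0 < x ⬝ᵥ x) (hy : 0 < y ⬝ᵥ y)
    (hxy : x ⬝ᵥ y = 0) (hAxy : x ⬝ᵥ B *ᵥ y = 0) (hQx : c * (x ⬝ᵥ x) ≤ x ⬝ᵥ B *ᵥ x)
    (hQy : c * (y ⬝ᵥ y) ≤ y ⬝ᵥ B *ᵥ y) : c ≤ hA.eigenvalues₀ ⟨1, hV⟩ := by
  have h1 : ∀ f g : ι → ℝ, Function.extend p f 0 ⬝ᵥ Function.extend p g 0 = f ⬝ᵥ g := by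
    intro f g
    rw [extend_zero_dotProduct hp, Function.extend_comp hp]
  have h2 : ∀ f g : ι → ℝ,
      Function.extend p f 0 ⬝ᵥ A *ᵥ Function.extend p g 0 = f ⬝ᵥ B *ᵥ g := by
    intro f g
    rw [extend_zero_dotProduct hp, mulVec_extend_zero_comp hp, hB]
  refine le_eigenvalues₀_one_of_test_vectors hA hV (x := Function.extend p x 0)
    (y := Function.extend p y 0) ?_ ?_ ?_ ?_ ?_ ?_ <;> simpa only [h1, h2]

end TestVectors

/-! ### Entries of the eccentricity matrix in terms of distances. -/

section EccMatrix

variable {V : Type*} {G : SimpleGraph V}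

theorem eccMatrix_comm (G : SimpleGraph V) (u v : V) : eccMatrix G u v = eccMatrix G v u := by
  simpa using (eccMatrix_isHermitian G).apply v u

theorem eccMatrix_self (G : SimpleGraph V) (u : V) : eccMatrix G u u = 0 := by
  simp [eccMatrix]

theorem eccMatrix_eq_dist (hG : G.Connected) {u v : V} (h : ∀ w, G.dist u w ≤ G.dist u v) :
    eccMatrix G u v = G.dist u v := by
  have h1 : G.eccent u ≤ G.edist u v := by
    rw [eccent_le_iff]
    intro w
    rw [← (hG u w).coe_dist_eq_edist, ← (hG u v).coe_dist_eq_edist]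
    exact_mod_cast h w
  have h2 : G.edist u v = min (G.eccent u) (G.eccent v) := by
    apply le_antisymm
    · exact le_min edist_le_eccent (by rw [edist_comm]; exact edist_le_eccent)
    · exact (min_le_left _ _).trans h1
  simp [eccMatrix, h2]

theorem eccMatrix_eq_zero (hG : G.Connected) {u v a b : V} (ha : G.dist u v < G.dist u a)
    (hb : G.dist u v < G.dist v b) : eccMatrix G u v = 0 := by
  have key : G.edist u v < min (G.eccent u) (G.eccent v) := by
    rw [lt_min_iff]
    constructor
    · refine lt_of_lt_of_le ?_ (edist_le_eccent (v := a))
      rw [← (hG u v).coe_dist_eq_edist, ← (hG u a).coe_dist_eq_edist]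
      exact_mod_cast ha
    · refine lt_of_lt_of_le ?_ (edist_le_eccent (v := b))
      rw [← (hG u v).coe_dist_eq_edist, ← (hG v b).coe_dist_eq_edist]
      exact_mod_cast hb
  simp [eccMatrix, key.ne]

end EccMatrix

/-! ### Distances and leaves in trees. -/

section Trees

variable {V : Type*} {T : SimpleGraph V}

/-- Geodesics from `u` to the two neighbours extend to paths from `u` to `v`. Paths in a tree are
unique, so their penultimate vertices agree. -/
theorem eq_of_adj_of_dist_succ_eq (hT : T.IsTree) {u v w w' : V} (hw : T.Adj v w)
    (hw' : T.Adj v w') (h : T.dist u w + 1 = T.dist u v) (h' : T.dist u w' + 1 = T.dist u v) :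
    w = w' := by
  obtain ⟨p, hp⟩ := hT.connected.exists_walk_length_eq_dist u w
  obtain ⟨q, hq⟩ := hT.connected.exists_walk_length_eq_dist u w'
  have hp' := (p.concat hw.symm).isPath_of_length_eq_dist (by rw [Walk.length_concat, hp, h])
  have hq' := (q.concat hw'.symm).isPath_of_length_eq_dist (by rw [Walk.length_concat, hq, h'])
  have := (hT.isAcyclic.subsingleton_path u v).elim ⟨_, hp'⟩ ⟨_, hq'⟩
  have := congrArg (fun r : T.Path u v => r.1.penultimate) this
  simpa using this

theorem exists_adj_dist_succ_eq (hG : T.Connected) {u v : V} (huv : u ≠ v) :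
    ∃ w, T.Adj v w ∧ T.dist u w + 1 = T.dist u v := by
  obtain ⟨p, hp⟩ := hG.exists_walk_length_eq_dist v u
  cases p with
  | nil => exact absurd rfl huv
  | cons h q =>
    rename_i w
    refine ⟨w, h, ?_⟩
    rw [Walk.length_cons] at hp
    have h1 := T.dist_le q
    have h2 := hG.dist_triangle (u := v) (v := w) (w := u)
    rw [dist_eq_one_iff_adj.mpr h] at h2
    rw [dist_comm, T.dist_comm (u := u)]
    omega

/-- A vertex of a tree farthest from some other vertex is a leaf. -/
theorem exists_unique_neighbor_of_farthest (hT : T.IsTree) {u v : V} (huv : u ≠ v)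
    (h : ∀ w, T.dist u w ≤ T.dist u v) :
    ∃ v', T.Adj v v' ∧ ∀ w, T.Adj v w → w = v' := by
  obtain ⟨v', hv', hd⟩ := exists_adj_dist_succ_eq hT.connected huv
  refine ⟨v', hv', fun w hw => eq_of_adj_of_dist_succ_eq hT hw hv' ?_ hd⟩
  have := hT.dist_eq_dist_add_one_of_adj u hw
  have := h w
  omega

theorem dist_eq_of_unique_neighbor (hG : T.Connected) {v v' : V}
    (h : ∀ w, T.Adj v w → w = v') {x : V} (hx : x ≠ v) : T.dist v x = T.dist v' x + 1 := by
  obtain ⟨w, hw, hd⟩ := exists_adj_dist_succ_eq hG hx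
  rw [h w hw, dist_comm, T.dist_comm (u := x)] at hd
  exact hd.symm

end Trees

/-! ### Diameter at least 4. -/

section LargeDiameter

variable {V : Type*} [Fintype V] {T : SimpleGraph V}

theorem vec4_injective {α : Type*} {a b c d : α} (hab : a ≠ b) (hac : a ≠ c) (had : a ≠ d)
    (hbc : b ≠ c) (hbd : b ≠ d) (hcd : c ≠ d) : Function.Injective ![a, b, c, d] := by
  intro i j hij
  fin_cases i <;> fin_cases j <;> simp_all

/-- As `u` and `v` are leaves, passing to `u'` or `v'` shortens distances by one, so `u'` and `v'`
have eccentricity `D - 1`. The pairs `uv`, `u'v`, `uv'` therefore attain the minimum eccentricity,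
and the other pairs among the four vertices do not. -/
theorem xi2_ge_of_four_le_diam (hT : T.IsTree) (hV : 2 ≤ Fintype.card V) {u v u' v' : V}
    (h : ∀ x w, T.dist x w ≤ T.dist u v) (hd : 4 ≤ T.dist u v) (hu' : T.Adj u u')
    (hu : ∀ w, T.Adj u w → w = u') (hv' : T.Adj v v') (hv : ∀ w, T.Adj v w → w = v') :
    4 / 3 ≤ xi2 T hV := by
  classical
  have hc := hT.connected
  have huv : v ≠ u := by rintro rfl; simp at hd
  have d1 : T.dist u u' = 1 := dist_eq_one_iff_adj.mpr hu'
  have d2 : T.dist v v' = 1 := dist_eq_one_iff_adj.mpr hv'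
  have d3 := dist_eq_of_unique_neighbor hc hu huv
  have d4 := dist_eq_of_unique_neighbor hc hv huv.symm
  have huv' : v' ≠ u := by
    rintro rfl
    rw [dist_comm] at d2
    omega
  have d5 := dist_eq_of_unique_neighbor hc hu huv'
  have hu'v : u' ≠ v := by
    rintro rfl
    omega
  have hu'v' : u' ≠ v' := by
    rintro rfl
    rw [T.dist_comm (u := v)] at d2
    omega
  have c1 : T.dist v u = T.dist u v := dist_comm
  have c2 : T.dist v' u = T.dist u v' := dist_comm
  have c3 : T.dist u' u = T.dist u u' := dist_comm
  have c4 : T.dist v' v = T.dist v v' := dist_comm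
  have c5 : T.dist v u' = T.dist u' v := dist_comm
  have c6 : T.dist v' u' = T.dist u' v' := dist_comm
  have eu' : ∀ w, T.dist u' w ≤ T.dist u' v := by
    intro w
    by_cases hw : w = u
    · subst hw; omega
    · have := dist_eq_of_unique_neighbor hc hu hw
      have := h u w
      omega
  have ev' : ∀ w, T.dist v' w ≤ T.dist v' u := by
    intro w
    by_cases hw : w = v
    · subst hw; omega
    · have := dist_eq_of_unique_neighbor hc hv hw
      have := h v w
      omega
  set D : ℝ := (T.dist u v : ℝ) with hD
  have m1 : eccMatrix T u v = D := eccMatrix_eq_dist hc (h u)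
  have m2 : eccMatrix T u' v = D - 1 := by
    rw [eccMatrix_eq_dist hc eu', hD, d3]; simp
  have m3 : eccMatrix T v' u = D - 1 := by
    rw [eccMatrix_eq_dist hc ev', hD, ← c1, d4]; simp
  have m4 : eccMatrix T u u' = 0 := eccMatrix_eq_zero hc (a := v) (b := v) (by omega) (by omega)
  have m5 : eccMatrix T v v' = 0 := eccMatrix_eq_zero hc (a := u) (b := u) (by omega) (by omega)
  have m6 : eccMatrix T u' v' = 0 := eccMatrix_eq_zero hc (a := v) (b := u) (by omega) (by omega)
  have hB : (eccMatrix T).submatrix ![u, u', v', v] ![u, u', v', v] =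
      !![0, 0, D - 1, D; 0, 0, 0, D - 1; D - 1, 0, 0, 0; D, D - 1, 0, 0] := by
    ext i j
    fin_cases i <;> fin_cases j <;>
      simp [eccMatrix_self, m1, m2, m3, m4, m5, m6, eccMatrix_comm T v u, eccMatrix_comm T v u',
        eccMatrix_comm T u v', eccMatrix_comm T u' u, eccMatrix_comm T v' v,
        eccMatrix_comm T v' u']
  have hD4 : 4 ≤ D := by rw [hD]; exact_mod_cast hd
  -- The submatrix is invariant under reversing the four vertices; `x` is symmetric and `y`
  -- antisymmetric, so both cross terms vanish. The Rayleigh quotients are `(6D - 4)/4` and `(6D -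
  -- 8)/10`, both above 4/3 for `D ≥ 4`.
  refine le_eigenvalues₀_one_of_submatrix (eccMatrix_isHermitian T) hV
    (vec4_injective hu'.ne huv'.symm huv.symm hu'v' hu'v hv'.symm.ne) hB
    (x := ![1, 1, 1, 1]) (y := ![1, -2, 2, -1]) ?_ ?_ ?_ ?_ ?_ ?_ <;>
    simp only [dotProduct, mulVec, Fin.sum_univ_four, of_apply, cons_val] <;> linarith

/-- In the complement a leaf of `T` misses only its neighbour, at distance 2. Since `D ≥ 4`, all
pairs between `{u, u'}` and `{v, v'}` become adjacent, at distance below both eccentricities. The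
submatrix splits into two blocks with eigenvalue 2. -/
theorem xi2_compl_ge_of_four_le_diam (hT : T.IsTree) (hTc : Tᶜ.Connected)
    (hV : 2 ≤ Fintype.card V) {u v u' v' : V}
    (hd : 4 ≤ T.dist u v) (hu' : T.Adj u u')
    (hu : ∀ w, T.Adj u w → w = u') (hv' : T.Adj v v') (hv : ∀ w, T.Adj v w → w = v') :
    2 ≤ xi2 Tᶜ hV := by
  classical
  have hc := hT.connected
  have huv : v ≠ u := by rintro rfl; simp at hd
  have d1 : T.dist u u' = 1 := dist_eq_one_iff_adj.mpr hu'
  have d2 : T.dist v v' = 1 := dist_eq_one_iff_adj.mpr hv'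
  have d3 := dist_eq_of_unique_neighbor hc hu huv
  have d4 := dist_eq_of_unique_neighbor hc hv huv.symm
  have huv' : v' ≠ u := by
    rintro rfl
    rw [dist_comm] at d2
    omega
  have d5 := dist_eq_of_unique_neighbor hc hu huv'
  have c1 : T.dist v u = T.dist u v := dist_comm
  have c2 : T.dist v' u = T.dist u v' := dist_comm
  have adj_of : ∀ x w, 2 ≤ T.dist x w → Tᶜ.Adj x w := by
    intro x w hxw
    rw [compl_adj]
    constructor
    · rintro rfl; simp at hxw
    · intro hadj
      rw [dist_eq_one_iff_adj.mpr hadj] at hxw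
      omega
  have a1 : Tᶜ.Adj u v := adj_of _ _ (by omega)
  have a2 : Tᶜ.Adj u' v := adj_of _ _ (by omega)
  have a3 : Tᶜ.Adj u v' := adj_of _ _ (by omega)
  have a4 : Tᶜ.Adj u' v' := adj_of _ _ (by omega)
  have dist_two : ∀ x w z, T.Adj x w → Tᶜ.Adj x z → Tᶜ.Adj w z → Tᶜ.dist x w = 2 := by
    intro x w z h1 h2 h3
    have := hTc.one_lt_dist_of_ne_of_not_adj h1.ne (by simp [compl_adj, h1])
    have := hTc.dist_triangle (u := x) (v := z) (w := w)
    rw [dist_eq_one_iff_adj.mpr h2, dist_eq_one_iff_adj.mpr h3.symm] at this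
    omega
  have e1 : Tᶜ.dist u u' = 2 := dist_two _ _ _ hu' a1 a2
  have e2 : Tᶜ.dist v v' = 2 := dist_two _ _ _ hv' a1.symm a3.symm
  have far : ∀ x x' : V, (∀ w, T.Adj x w → w = x') → Tᶜ.dist x x' = 2 →
      ∀ w, Tᶜ.dist x w ≤ Tᶜ.dist x x' := by
    intro x x' hx h2 w
    by_cases hw : w = x'
    · rw [hw]
    by_cases hwx : x = w
    · rw [hwx]; simp
    have : Tᶜ.Adj x w := by
      rw [compl_adj]
      exact ⟨hwx, fun h => hw (hx w h)⟩
    rw [dist_eq_one_iff_adj.mpr this]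
    omega
  have m1 : eccMatrix Tᶜ u u' = 2 := by
    rw [eccMatrix_eq_dist hTc (far u u' hu e1), e1]; norm_num
  have m2 : eccMatrix Tᶜ v v' = 2 := by
    rw [eccMatrix_eq_dist hTc (far v v' hv e2), e2]; norm_num
  have cross : ∀ x x' y y' : V, Tᶜ.Adj x y → Tᶜ.dist x x' = 2 → Tᶜ.dist y y' = 2 →
      eccMatrix Tᶜ x y = 0 := by
    intro x x' y y' h1 h2 h3
    apply eccMatrix_eq_zero hTc (a := x') (b := y') <;>
      rw [dist_eq_one_iff_adj.mpr h1] <;> omega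
  have e1' : Tᶜ.dist u' u = 2 := by rw [dist_comm]; exact e1
  have e2' : Tᶜ.dist v' v = 2 := by rw [dist_comm]; exact e2
  have m3 := cross _ _ _ _ a1 e1 e2
  have m4 := cross _ _ _ _ a2 e1' e2
  have m5 := cross _ _ _ _ a3 e1 e2'
  have m6 := cross _ _ _ _ a4 e1' e2'
  have hB : (eccMatrix Tᶜ).submatrix ![u, u', v', v] ![u, u', v', v] =
      !![0, 2, 0, 0; 2, 0, 0, 0; 0, 0, 0, 2; 0, 0, 2, 0] := by
    ext i j
    fin_cases i <;> fin_cases j <;>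
      simp [eccMatrix_self, m1, m2, m3, m4, m5, m6, eccMatrix_comm Tᶜ v u, eccMatrix_comm Tᶜ v u',
        eccMatrix_comm Tᶜ v' u, eccMatrix_comm Tᶜ u' u, eccMatrix_comm Tᶜ v' v,
        eccMatrix_comm Tᶜ v' u']
  refine le_eigenvalues₀_one_of_submatrix (eccMatrix_isHermitian Tᶜ) hV
    (vec4_injective hu'.ne a3.ne a1.ne a4.ne a2.ne hv'.symm.ne) hB
    (x := ![1, 1, 0, 0]) (y := ![0, 0, 1, 1]) ?_ ?_ ?_ ?_ ?_ ?_ <;>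
    simp only [dotProduct, mulVec, Fin.sum_univ_four, of_apply, cons_val] <;> linarith

end LargeDiameter

/-! ### Distances and eccentricities determined by a partition into four cells. -/

section Cells

variable {V : Type*} {G : SimpleGraph V} {κ : V → Fin 4}

theorem Connected.dist_eq_two_of_common_neighbor (hG : G.Connected) {u v w : V} (huv : u ≠ v)
    (h : ¬ G.Adj u v) (huw : G.Adj u w) (hwv : G.Adj w v) : G.dist u v = 2 := by
  have h1 := hG.one_lt_dist_of_ne_of_not_adj huv h
  have h2 := hG.dist_triangle (u := u) (v := w) (w := v)
  rw [dist_eq_one_iff_adj.mpr huw, dist_eq_one_iff_adj.mpr hwv] at h2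
  omega

theorem Connected.dist_eq_three_of_walk (hG : G.Connected) {u v a b : V} (huv : u ≠ v)
    (h : ¬ G.Adj u v) (hn : ∀ w, ¬ (G.Adj u w ∧ G.Adj w v)) (hua : G.Adj u a) (hab : G.Adj a b)
    (hbv : G.Adj b v) : G.dist u v = 3 := by
  have h1 := hG.one_lt_dist_of_ne_of_not_adj huv h
  have h2 := hG.dist_triangle (u := u) (v := a) (w := v)
  have h3 := hG.dist_triangle (u := a) (v := b) (w := v)
  rw [dist_eq_one_iff_adj.mpr hua] at h2
  rw [dist_eq_one_iff_adj.mpr hab, dist_eq_one_iff_adj.mpr hbv] at h3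
  have h4 : G.dist u v ≠ 2 := by
    intro h2
    obtain ⟨w, hw, hd⟩ := exists_adj_dist_succ_eq hG huv
    rw [h2] at hd
    exact hn w ⟨dist_eq_one_iff_adj.mp (by omega), hw.symm⟩
  omega

/-- Distances in a graph whose adjacency is determined by a relation `B` between cells; the
cells `1` and `2` are singletons. -/
theorem dist_eq_of_cells (hG : G.Connected) (hκ : Function.Surjective κ)
    (hs : ∀ u v, κ u = κ v → κ u = 1 ∨ κ u = 2 → u = v) {B : Fin 4 → Fin 4 → Prop}
    (hB : ∀ u v, G.Adj u v ↔ u ≠ v ∧ B (κ u) (κ v)) {D : Fin 4 → Fin 4 → ℕ}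
    (hD : ∀ i j, (i = j ∧ (i = 1 ∨ i = 2)) ∨ (B i j ∧ D i j = 1) ∨
      (¬ B i j ∧ D i j = 2 ∧ ∃ k, k ≠ i ∧ k ≠ j ∧ B i k ∧ B k j) ∨
      (¬ B i j ∧ D i j = 3 ∧ (∀ k, ¬ (B i k ∧ B k j)) ∧
        ∃ k l, i ≠ k ∧ k ≠ l ∧ l ≠ j ∧ B i k ∧ B k l ∧ B l j))
    {u v : V} (huv : u ≠ v) : G.dist u v = D (κ u) (κ v) := by
  have hne : ∀ {x y : V}, κ x ≠ κ y → x ≠ y := fun h h' => h (congrArg κ h')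
  rcases hD (κ u) (κ v) with ⟨h1, h2⟩ | ⟨h1, h2⟩ | ⟨h1, h2, k, hk, hk', hb, hb'⟩ |
    ⟨h1, h2, h3, k, l, hk, hkl, hl, hb, hb', hb''⟩
  · exact absurd (hs u v h1 h2) huv
  · rw [h2, dist_eq_one_iff_adj, hB]
    exact ⟨huv, h1⟩
  -- The intermediate cell differs from both end cells, so any vertex in it is distinct from the
  -- ends, even when an end cell is a singleton.
  · obtain ⟨w, rfl⟩ := hκ k
    rw [h2]
    exact Connected.dist_eq_two_of_common_neighbor hG huv (fun h => h1 ((hB _ _).mp h).2)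
      ((hB _ _).mpr ⟨hne hk.symm, hb⟩) ((hB _ _).mpr ⟨hne hk', hb'⟩)
  · obtain ⟨a, rfl⟩ := hκ k
    obtain ⟨b, rfl⟩ := hκ l
    rw [h2]
    exact Connected.dist_eq_three_of_walk hG huv (fun h => h1 ((hB _ _).mp h).2)
      (fun w hw => h3 _ ⟨((hB _ _).mp hw.1).2, ((hB _ _).mp hw.2).2⟩)
      ((hB _ _).mpr ⟨hne hk, hb⟩) ((hB _ _).mpr ⟨hne hkl, hb'⟩) ((hB _ _).mpr ⟨hne hl, hb''⟩)

/-- The eccentricity matrix is constant on cells when distances are. -/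
theorem eccMatrix_eq_of_cells (hG : G.Connected) (hκ : Function.Surjective κ)
    {D W : Fin 4 → Fin 4 → ℕ} (hd : ∀ u v, u ≠ v → G.dist u v = D (κ u) (κ v))
    (hW : ∀ i j, (W i j = D i j ∧ i ≠ j ∧ ((∀ k, D i k ≤ D i j) ∨ (∀ k, D j k ≤ D j i))) ∨
      (W i j = 0 ∧ (∃ k, k ≠ i ∧ D i j < D i k) ∧ ∃ k, k ≠ j ∧ D i j < D j k)) (u v : V) :
    eccMatrix G u v = W (κ u) (κ v) := by
  have hfar : ∀ u v : V, u ≠ v → (∀ k, D (κ u) k ≤ D (κ u) (κ v)) →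
      eccMatrix G u v = D (κ u) (κ v) := by
    intro u v huv h
    rw [eccMatrix_eq_dist hG, hd u v huv]
    intro w
    by_cases hw : u = w
    · subst hw; simp
    · rw [hd u w hw, hd u v huv]
      exact h _
  by_cases huv : u = v
  · subst huv
    rcases hW (κ u) (κ u) with ⟨-, h, -⟩ | ⟨h, -⟩
    · exact absurd rfl h
    · rw [eccMatrix_self, h, Nat.cast_zero]
  rcases hW (κ u) (κ v) with ⟨h, -, h1 | h1⟩ | ⟨h, ⟨k, hk, h1⟩, l, hl, h2⟩
  · rw [hfar u v huv h1, h]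
  · rw [eccMatrix_comm, hfar v u (Ne.symm huv) h1, h, ← hd u v huv, ← hd v u (Ne.symm huv),
      dist_comm]
  · obtain ⟨a, rfl⟩ := hκ k
    obtain ⟨b, rfl⟩ := hκ l
    have ha : u ≠ a := by rintro rfl; exact hk rfl
    have hb : v ≠ b := by rintro rfl; exact hl rfl
    rw [h, Nat.cast_zero]
    apply eccMatrix_eq_zero hG (a := a) (b := b)
    · rw [hd u v huv, hd u a ha]; exact h1
    · rw [hd u v huv, hd v b hb]; exact h2

end Cells

/-! ### Double stars: eccentricity matrices, isomorphism type, and diameter 3. -/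

section DoubleStar

variable {V : Type*} {T : SimpleGraph V} {κ : V → Fin 4}

/-- Adjacency in the path on four vertices. -/
def PathAdj (i j : Fin 4) : Prop := (i : ℕ) + 1 = j ∨ (j : ℕ) + 1 = i

instance : DecidableRel PathAdj := fun i j => by unfold PathAdj; infer_instance

/-- `T` is a double star with centers the unique vertices in the cells `1` and `2` of `κ`, and
with leaves in the cells `0` and `3`. -/
structure IsDoubleStar (T : SimpleGraph V) (κ : V → Fin 4) : Prop where
  adj_iff : ∀ u v, T.Adj u v ↔ PathAdj (κ u) (κ v)
  surjective : Function.Surjective κ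
  eq_of_center : ∀ u v, κ u = κ v → κ u = 1 ∨ κ u = 2 → u = v

theorem IsDoubleStar.rev (h : IsDoubleStar T κ) : IsDoubleStar T (Fin.rev ∘ κ) where
  adj_iff u v := by
    rw [h.adj_iff]
    have : ∀ i j : Fin 4, PathAdj i j ↔ PathAdj i.rev j.rev := by decide
    exact this _ _
  surjective := Fin.rev_surjective.comp h.surjective
  eq_of_center u v huv hu := by
    refine h.eq_of_center u v (Fin.rev_injective huv) ?_
    have : ∀ i : Fin 4, i.rev = 1 ∨ i.rev = 2 → i = 1 ∨ i = 2 := by decide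
    exact this _ hu

/-- Leaves have eccentricity 3 and centers 2, so the surviving entries join leaves of different
centers (3) and a center to the leaves of the other (2). Along the weighted path the cells come in
the order 1, 3, 0, 2. -/
theorem IsDoubleStar.eccMatrix_eq (h : IsDoubleStar T κ) (hT : T.Connected) :
    eccMatrix T = pathWeight.submatrix ((![2, 0, 3, 1] : Fin 4 → Fin 4) ∘ κ)
      ((![2, 0, 3, 1] : Fin 4 → Fin 4) ∘ κ) := by
  ext u v
  rw [eccMatrix_eq_of_cells (D := ![![2, 1, 2, 3], ![1, 0, 1, 2], ![2, 1, 0, 1], ![3, 2, 1, 2]])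
    (W := ![![0, 0, 2, 3], ![0, 0, 0, 2], ![2, 0, 0, 0], ![3, 2, 0, 0]]) hT h.surjective ?_
    (by decide)]
  · simp only [submatrix_apply, Function.comp_apply]
    generalize κ u = i
    generalize κ v = j
    fin_cases i <;> fin_cases j <;> simp [pathWeight]
  · intro u v huv
    refine dist_eq_of_cells hT h.surjective h.eq_of_center (B := PathAdj) ?_ (by decide) huv
    intro x y
    rw [← h.adj_iff]
    exact ⟨fun hxy => ⟨hxy.ne, hxy⟩, And.right⟩

/-- In the complement the centers are at distance 3 and have eccentricity 3, while leaves have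
eccentricity 2, attained at their own center. Here the cells keep their order along the weighted
path. -/
theorem IsDoubleStar.eccMatrix_compl_eq (h : IsDoubleStar T κ) (hT : Tᶜ.Connected) :
    eccMatrix Tᶜ = pathWeight.submatrix κ κ := by
  ext u v
  rw [eccMatrix_eq_of_cells (D := ![![1, 2, 1, 1], ![2, 0, 3, 1], ![1, 3, 0, 2], ![1, 1, 2, 1]])
    (W := ![![0, 2, 0, 0], ![2, 0, 3, 0], ![0, 3, 0, 2], ![0, 0, 2, 0]]) hT h.surjective ?_
    (by decide)]
  · simp only [submatrix_apply]
    generalize κ u = i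
    generalize κ v = j
    fin_cases i <;> fin_cases j <;> simp [pathWeight]
  · intro u v huv
    refine dist_eq_of_cells hT h.surjective h.eq_of_center (B := fun i j => ¬ PathAdj i j) ?_
      (by decide) huv
    intro x y
    rw [← h.adj_iff, compl_adj]

/-- Double stars with the same cell sizes are isomorphic. -/
theorem IsDoubleStar.nonempty_iso {V' : Type*} {T' : SimpleGraph V'} {κ' : V' → Fin 4}
    [Fintype V] [Fintype V'] (h : IsDoubleStar T κ) (h' : IsDoubleStar T' κ')
    (hc : ∀ i, Finset.card {u | κ u = i} = Finset.card {u | κ' u = i}) :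
    Nonempty (T ≃g T') := by
  have : ∀ i, Nonempty ({u // κ u = i} ≃ {u // κ' u = i}) := by
    intro i
    rw [← Fintype.card_eq, Fintype.card_subtype, Fintype.card_subtype, hc]
  let e := fun i => Classical.choice (this i)
  let E : V ≃ V' := (Equiv.sigmaFiberEquiv κ).symm.trans
    ((Equiv.sigmaCongrRight e).trans (Equiv.sigmaFiberEquiv κ'))
  have hE : ∀ u, κ' (E u) = κ u := fun u => (e (κ u) ⟨u, rfl⟩).2
  exact ⟨⟨E, by intro u v; rw [h'.adj_iff, h.adj_iff, hE, hE]⟩⟩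

theorem IsDoubleStar.comp_iso {V' : Type*} {T' : SimpleGraph V'} {κ' : V' → Fin 4}
    (h' : IsDoubleStar T' κ') (e : T ≃g T') : IsDoubleStar T (κ' ∘ e) where
  adj_iff u v := by rw [← e.map_adj_iff, h'.adj_iff]; rfl
  surjective := h'.surjective.comp e.surjective
  eq_of_center u v huv hu := e.injective (h'.eq_of_center _ _ huv hu)

/-- The cells of `treeT3 a b`. -/
def treeT3Cell (a b : ℕ) : Fin 4 ⊕ (Fin a ⊕ Fin b) → Fin 4 :=
  Sum.elim id (Sum.elim (fun _ => 0) fun _ => 3)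

theorem treeT3_isDoubleStar (a b : ℕ) : IsDoubleStar (treeT3 a b) (treeT3Cell a b) where
  adj_iff u v := by
    rcases u with i | u | u <;> rcases v with j | v | v <;>
      simp only [treeT3, fromRel_adj, treeT3Cell, PathAdj, Sum.elim_inl, Sum.elim_inr, id]
    · constructor
      · exact And.right
      · refine fun h => ⟨fun h' => ?_, h⟩
        rw [Sum.inl.injEq] at h'
        subst h'
        omega
    all_goals try fin_cases i
    all_goals try fin_cases j
    all_goals simp
  surjective i := ⟨Sum.inl i, rfl⟩
  eq_of_center u v huv hu := by
    rcases u with i | u | u <;> rcases v with j | v | v <;>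
      simp_all [treeT3Cell]

theorem IsDoubleStar.card_center [Fintype V] (h : IsDoubleStar T κ) {i : Fin 4}
    (hi : i = 1 ∨ i = 2) : Finset.card {u | κ u = i} = 1 := by
  obtain ⟨w, hw⟩ := h.surjective i
  rw [Finset.card_eq_one]
  refine ⟨w, ?_⟩
  ext u
  simp only [Finset.mem_filter, Finset.mem_univ, true_and, Finset.mem_singleton]
  constructor
  · intro hu
    exact h.eq_of_center u w (hu.trans hw.symm) (hu ▸ hi)
  · rintro rfl
    exact hw

theorem IsDoubleStar.card_pos [Fintype V] (h : IsDoubleStar T κ) (i : Fin 4) :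
    0 < Finset.card {u | κ u = i} := by
  obtain ⟨w, hw⟩ := h.surjective i
  exact Finset.card_pos.mpr ⟨w, by simp [hw]⟩

theorem IsDoubleStar.card_eq [Fintype V] (h : IsDoubleStar T κ) :
    Finset.card {u | κ u = 0} + Finset.card {u | κ u = 3} + 2 = Fintype.card V := by
  have := Finset.card_eq_sum_card_fiberwise (f := κ) (s := Finset.univ) (t := Finset.univ)
    (fun _ _ => Finset.mem_coe.mpr (Finset.mem_univ _))
  rw [Fin.sum_univ_four, h.card_center (Or.inl rfl), h.card_center (Or.inr rfl),
    Finset.card_univ] at this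
  omega

theorem treeT3Cell_card_zero (b : ℕ) :
    Finset.card {u | treeT3Cell 0 b u = 0} = 1 := by
  rw [Finset.card_eq_one]
  refine ⟨Sum.inl 0, ?_⟩
  ext u
  rw [Finset.mem_filter, Finset.mem_singleton]
  rcases u with i | u | u
  · simp [treeT3Cell]
  · exact u.elim0
  · simp [treeT3Cell]

/-- A double star whose first leaf cell is a singleton is isomorphic to `treeT3 0 (n - 4)`. -/
theorem IsDoubleStar.nonempty_iso_treeT3 [Fintype V] (h : IsDoubleStar T κ)
    (h0 : Finset.card {u | κ u = 0} = 1) (hV : 4 ≤ Fintype.card V) :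
    Nonempty (T ≃g treeT3 0 (Fintype.card V - 4)) := by
  have h' := treeT3_isDoubleStar 0 (Fintype.card V - 4)
  refine h.nonempty_iso h' fun i => ?_
  have e1 := h.card_eq
  have e2 := h'.card_eq
  have e3 := treeT3Cell_card_zero (Fintype.card V - 4)
  simp only [Fintype.card_sum, Fintype.card_fin] at e2
  fin_cases i
  · exact h0.trans e3.symm
  · exact (h.card_center (Or.inl rfl)).trans (h'.card_center (Or.inl rfl)).symm
  · exact (h.card_center (Or.inr rfl)).trans (h'.card_center (Or.inr rfl)).symm
  · change Finset.card {u | κ u = 3} =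
      Finset.card {u | treeT3Cell 0 (Fintype.card V - 4) u = 3}
    omega

/-- Every vertex is within 2 of both `u'` and `v'`, and its distances to these adjacent vertices
differ, since a tree is bipartite. So each vertex other than `u'` and `v'` is adjacent to exactly
one of them. -/
theorem exists_isDoubleStar_of_diam_eq_three (hT : T.IsTree) {u v u' v' : V}
    (h : ∀ x w, T.dist x w ≤ T.dist u v) (hd : T.dist u v = 3) (hu' : T.Adj u u')
    (hu : ∀ w, T.Adj u w → w = u') (hv' : T.Adj v v') (hv : ∀ w, T.Adj v w → w = v') :
    ∃ κ, IsDoubleStar T κ := by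
  classical
  have hc := hT.connected
  have huv : v ≠ u := by rintro rfl; simp at hd
  have d1 : T.dist u u' = 1 := dist_eq_one_iff_adj.mpr hu'
  have d2 : T.dist v v' = 1 := dist_eq_one_iff_adj.mpr hv'
  have c1 : T.dist v u = T.dist u v := dist_comm
  have c2 : T.dist v' u = T.dist u v' := dist_comm
  have d3 := dist_eq_of_unique_neighbor hc hu huv
  have d4 := dist_eq_of_unique_neighbor hc hv huv.symm
  have huv' : v' ≠ u := by
    rintro rfl
    simp at d4
    omega
  have d5 := dist_eq_of_unique_neighbor hc hu huv'
  have hadj : T.Adj u' v' := dist_eq_one_iff_adj.mp (by omega)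
  have far : ∀ {x y y' : V}, T.Adj y y' → (∀ w, T.Adj y w → w = y') → T.dist y' x ≤ 2 := by
    intro x y y' hy hy'
    by_cases hx : x = y
    · subst hx
      rw [dist_eq_one_iff_adj.mpr hy.symm]
      omega
    · have := dist_eq_of_unique_neighbor hc hy' hx
      have := h y x
      omega
  have fu : ∀ x, T.dist u' x ≤ 2 := fun x => far hu' hu
  have fv : ∀ x, T.dist v' x ≤ 2 := fun x => far hv' hv
  have du : ∀ {x}, x ≠ u' → x ≠ v' → (T.dist u' x = 1 ∧ T.dist v' x = 2 ∨
      T.dist u' x = 2 ∧ T.dist v' x = 1) := by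
    intro x h1 h2
    have p1 := hc.pos_dist_of_ne h1.symm
    have p2 := hc.pos_dist_of_ne h2.symm
    have p3 := hT.dist_ne_of_adj x hadj
    rw [T.dist_comm (u := x), T.dist_comm (u := x)] at p3
    have := fu x
    have := fv x
    omega
  let κ : V → Fin 4 := fun x => if x = u' then 1 else if x = v' then 2 else
    if T.Adj u' x then 0 else 3
  have hne := hadj.ne
  have k1 : κ u' = 1 := by simp [κ]
  have k2 : κ v' = 2 := by simp [κ, hne.symm]
  have cases_κ : ∀ x, (x = u' ∧ κ x = 1) ∨ (x = v' ∧ κ x = 2) ∨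
      (x ≠ u' ∧ x ≠ v' ∧ κ x = 0 ∧ T.Adj u' x ∧ ¬ T.Adj v' x) ∨
      (x ≠ u' ∧ x ≠ v' ∧ κ x = 3 ∧ ¬ T.Adj u' x ∧ T.Adj v' x) := by
    intro x
    by_cases h1 : x = u'
    · exact Or.inl ⟨h1, h1 ▸ k1⟩
    by_cases h2 : x = v'
    · exact Or.inr (Or.inl ⟨h2, h2 ▸ k2⟩)
    rw [← dist_eq_one_iff_adj, ← dist_eq_one_iff_adj]
    rcases du h1 h2 with ⟨h3, h4⟩ | ⟨h3, h4⟩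
    · refine Or.inr (Or.inr (Or.inl ⟨h1, h2, ?_, h3, by omega⟩))
      simp [κ, h1, h2, dist_eq_one_iff_adj.mp h3]
    · refine Or.inr (Or.inr (Or.inr ⟨h1, h2, ?_, by omega, h4⟩))
      have : ¬ T.Adj u' x := by rw [← dist_eq_one_iff_adj]; omega
      simp [κ, h1, h2, this]
  have leaf_not_adj : ∀ x y, x ≠ u' → x ≠ v' → y ≠ u' → y ≠ v' → ¬ T.Adj x y := by
    intro x y hx hx' hy hy' hxy
    have p := hT.dist_ne_of_adj u' hxy
    -- An edge between leaves of different centers would give `b` two predecessors as seen from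
    -- `u'`, namely `a` and `v'`.
    have key : ∀ a b, T.Adj a b → a ≠ v' → T.dist u' a = 1 → T.dist u' b = 2 →
        T.dist v' b = 1 → False := by
      intro a b hab ha h1 h2 h3
      refine ha (eq_of_adj_of_dist_succ_eq hT (u := u') (v := b) hab.symm
        (dist_eq_one_iff_adj.mp h3).symm (by omega) ?_)
      rw [dist_eq_one_iff_adj.mpr hadj, h2]
    rcases du hx hx' with ⟨h1, h2⟩ | ⟨h1, h2⟩ <;> rcases du hy hy' with ⟨h3, h4⟩ | ⟨h3, h4⟩
    · omega
    · exact key x y hxy hx' h1 h3 h4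
    · exact key y x hxy.symm hy' h3 h1 h2
    · omega
  have hu0 : κ u = 0 := by
    rcases cases_κ u with ⟨e, -⟩ | ⟨e, -⟩ | ⟨-, -, e, -⟩ | ⟨-, -, -, e, -⟩
    · exact absurd e hu'.ne
    · exact absurd e.symm huv'
    · exact e
    · exact absurd hu'.symm e
  have hv3 : κ v = 3 := by
    rcases cases_κ v with ⟨e, -⟩ | ⟨e, -⟩ | ⟨-, -, -, -, e⟩ | ⟨-, -, e, -⟩
    · subst e; omega
    · exact absurd e hv'.ne
    · exact absurd hv'.symm e
    · exact e
  refine ⟨κ, ?_, ?_, ?_⟩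
  · intro x y
    rcases cases_κ x with ⟨rfl, e⟩ | ⟨rfl, e⟩ | ⟨a1, a2, e, a3, a4⟩ | ⟨a1, a2, e, a3, a4⟩ <;>
    rcases cases_κ y with ⟨rfl, e'⟩ | ⟨rfl, e'⟩ | ⟨b1, b2, e', b3, b4⟩ | ⟨b1, b2, e', b3, b4⟩ <;>
    simp only [e, e'] <;> first | (simp [PathAdj, *]; done) | (rw [T.adj_comm]; simp [PathAdj, *])
  · intro i
    fin_cases i
    exacts [⟨u, hu0⟩, ⟨u', k1⟩, ⟨v', k2⟩, ⟨v, hv3⟩]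
  · intro x y hxy hx
    rcases cases_κ x with ⟨rfl, e⟩ | ⟨rfl, e⟩ | ⟨a1, a2, e, a3, a4⟩ | ⟨a1, a2, e, a3, a4⟩ <;>
    rcases cases_κ y with ⟨rfl, e'⟩ | ⟨rfl, e'⟩ | ⟨b1, b2, e', b3, b4⟩ | ⟨b1, b2, e', b3, b4⟩ <;>
    simp only [e, e'] at hx hxy <;> simp at hx hxy ⊢

end DoubleStar

/-! ### Locating the smaller root of a quadratic. -/

section QuadraticRoots

/-- The square root of the smaller root of `x ^ 2 - S * x + D`. -/
noncomputable def sqrtSmallRoot (S D : ℝ) : ℝ := Real.sqrt ((S - Real.sqrt (S ^ 2 - 4 * D)) / 2)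

variable {S D : ℝ}

theorem sqrt_discrim_lt (hS : 0 < S) (hD : 0 < D) : Real.sqrt (S ^ 2 - 4 * D) < S := by
  rw [Real.sqrt_lt' hS]
  linarith

theorem sqrtSmallRoot_pos (hS : 0 < S) (hD : 0 < D) : 0 < sqrtSmallRoot S D :=
  Real.sqrt_pos.mpr (by linarith [sqrt_discrim_lt hS hD])

theorem sqrtSmallRoot_sq (hS : 0 < S) (hD : 0 < D) :
    sqrtSmallRoot S D ^ 2 = (S - Real.sqrt (S ^ 2 - 4 * D)) / 2 :=
  Real.sq_sqrt (by linarith [sqrt_discrim_lt hS hD])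

theorem sqrtSmallRoot_eq (hS : 0 < S) (hD : 0 < D) (hd : 4 * D < S ^ 2) :
    (sqrtSmallRoot S D ^ 2) ^ 2 - S * sqrtSmallRoot S D ^ 2 + D = 0 := by
  rw [sqrtSmallRoot_sq hS hD]
  linear_combination (1 / 4) * Real.sq_sqrt (sub_nonneg.mpr hd.le)

theorem two_mul_sqrtSmallRoot_sq_lt (hS : 0 < S) (hD : 0 < D) (hd : 4 * D < S ^ 2) :
    2 * sqrtSmallRoot S D ^ 2 < S := by
  rw [sqrtSmallRoot_sq hS hD]
  linarith [Real.sqrt_pos.mpr (sub_pos.mpr hd)]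

theorem lt_sqrtSmallRoot (hS : 0 < S) (hD : 0 < D) (hd : 4 * D < S ^ 2) {y : ℝ}
    (hy : 2 * y ^ 2 ≤ S) (h : 0 < (y ^ 2) ^ 2 - S * y ^ 2 + D) : y < sqrtSmallRoot S D := by
  have h1 := sqrtSmallRoot_eq hS hD hd
  have h2 := two_mul_sqrtSmallRoot_sq_lt hS hD hd
  refine lt_of_pow_lt_pow_left₀ 2 (sqrtSmallRoot_pos hS hD).le ?_
  by_contra hcon
  push Not at hcon
  -- With `r` the smaller root, the quadratic at `y²` is `-(y² - r)(S - y² - r)`; the condition `2y²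
  -- ≤ S` keeps `y²` from passing the larger root.
  nlinarith [mul_nonneg (sub_nonneg.mpr hcon)
    (by linarith : 0 ≤ S - y ^ 2 - sqrtSmallRoot S D ^ 2)]

theorem sqrtSmallRoot_lt (hS : 0 < S) (hD : 0 < D) (hd : 4 * D < S ^ 2) {y : ℝ} (hy : 0 ≤ y)
    (h : (y ^ 2) ^ 2 - S * y ^ 2 + D < 0) : sqrtSmallRoot S D < y := by
  have h1 := sqrtSmallRoot_eq hS hD hd
  have h2 := two_mul_sqrtSmallRoot_sq_lt hS hD hd
  refine lt_of_pow_lt_pow_left₀ 2 hy ?_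
  by_contra hcon
  push Not at hcon
  nlinarith [mul_nonneg (sub_nonneg.mpr hcon)
    (by linarith : 0 ≤ S - y ^ 2 - sqrtSmallRoot S D ^ 2)]

end QuadraticRoots

/-! ### Estimates and monotonicity in `m = pq`, with `k = p + q`. -/

section Bounds

variable {k m : ℝ}

theorem discrim_tree (hk : 2 ≤ k) (hm : 1 ≤ m) : 4 * (16 * m) < (4 * k + 9 * m) ^ 2 := by
  nlinarith [mul_nonneg (by linarith : (0 : ℝ) ≤ k - 2) (by linarith : (0 : ℝ) ≤ m - 1)]

theorem discrim_compl (hk : 2 ≤ k) (hm : 4 * m ≤ k ^ 2) :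
    4 * (16 * m) < (4 * k + 9) ^ 2 := by
  nlinarith

/-- The quadratic is `x² - 4kx + m(16 - 9x)`, so at `x = 16/9` the term in `m` vanishes and the
value is negative. This is the source of 4/3. -/
theorem sqrtSmallRoot_tree_lt (hk : 2 ≤ k) (hm : 1 ≤ m) :
    sqrtSmallRoot (4 * k + 9 * m) (16 * m) < 4 / 3 :=
  sqrtSmallRoot_lt (by linarith) (by linarith) (discrim_tree hk hm) (by norm_num) (by nlinarith)

theorem sqrtSmallRoot_compl_lt (hk : 2 ≤ k) (hm0 : 1 ≤ m) (hm : 4 * m ≤ k ^ 2) (hmk : m ≤ k - 1) :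
    sqrtSmallRoot (4 * k + 9) (16 * m) < 2 :=
  sqrtSmallRoot_lt (by linarith) (by linarith) (discrim_compl hk hm) (by norm_num) (by nlinarith)

/-- The coefficient `16 - 9x` of `m` is positive at the old root, which lies below 16/9. Raising `m`
makes the quadratic positive there and pushes the smaller root to the right. -/
theorem sqrtSmallRoot_tree_lt_of_lt {m' : ℝ} (hk : 2 ≤ k) (hm : 1 ≤ m) (h : m < m') :
    sqrtSmallRoot (4 * k + 9 * m) (16 * m) < sqrtSmallRoot (4 * k + 9 * m') (16 * m') := by
  have h0 := sqrtSmallRoot_pos (S := 4 * k + 9 * m) (D := 16 * m) (by linarith) (by linarith)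
  have h1 := sqrtSmallRoot_tree_lt hk hm
  have h2 := sqrtSmallRoot_eq (by linarith) (by linarith) (discrim_tree hk hm)
  have h3 := two_mul_sqrtSmallRoot_sq_lt (by linarith) (by linarith) (discrim_tree hk hm)
  refine lt_sqrtSmallRoot (by linarith) (by linarith) (discrim_tree hk (by linarith))
    (by linarith) ?_
  set y := sqrtSmallRoot (4 * k + 9 * m) (16 * m)
  have h4 : y ^ 2 < 16 / 9 := by nlinarith
  nlinarith [mul_pos (sub_pos.mpr h) (by linarith : (0 : ℝ) < 16 - 9 * y ^ 2)]

/-- Only the constant term depends on `m`; the bound `4m' ≤ k²`, which is AM-GM for `m' = pq`, keeps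
the discriminant positive. -/
theorem sqrtSmallRoot_compl_lt_of_lt {m' : ℝ} (hk : 2 ≤ k) (hm : 1 ≤ m) (h : m < m')
    (hm' : 4 * m' ≤ k ^ 2) :
    sqrtSmallRoot (4 * k + 9) (16 * m) < sqrtSmallRoot (4 * k + 9) (16 * m') := by
  have hd := discrim_compl hk (by linarith : 4 * m ≤ k ^ 2)
  have h2 := sqrtSmallRoot_eq (by linarith) (by linarith) hd
  have h3 := two_mul_sqrtSmallRoot_sq_lt (by linarith) (by linarith) hd
  exact lt_sqrtSmallRoot (by linarith) (by linarith) (discrim_compl hk hm')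
    h3.le (by linarith)

end Bounds

/-! ### Values for double stars and the choice of a diametral pair. -/

section Main

variable {V : Type*} [Fintype V] {T : SimpleGraph V}

theorem IsDoubleStar.xi2_eq {κ : V → Fin 4} (h : IsDoubleStar T κ) (hT : T.Connected)
    (hV : 2 ≤ Fintype.card V) {p q : ℝ} (hp : (Finset.card {u | κ u = 0} : ℝ) = p)
    (hq : (Finset.card {u | κ u = 3} : ℝ) = q) (hp1 : 1 ≤ p) (hq1 : 1 ≤ q) :
    xi2 T hV = sqrtSmallRoot (4 * (p + q) + 9 * (p * q)) (16 * (p * q)) := by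
  classical
  have hpq : 1 ≤ p * q := one_le_mul_of_one_le_of_one_le hp1 hq1
  have hd := discrim_tree (k := p + q) (by linarith) hpq
  have hS : 0 < 4 * (p + q) + 9 * (p * q) := by linarith
  have hD : 0 < 16 * (p * q) := by linarith
  have h1 := sqrtSmallRoot_eq hS hD hd
  have h2 := two_mul_sqrtSmallRoot_sq_lt hS hD hd
  have c1 := h.card_center (Or.inl rfl)
  have c2 := h.card_center (Or.inr rfl)
  refine eigenvalues₀_one_submatrix (m := ![1, q, p, 1]) ?_ ?_ (h.eccMatrix_eq hT)
    (eccMatrix_isHermitian T) hV (sqrtSmallRoot_pos hS hD) ?_ ?_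
  · have key : ∀ i j : Fin 4, (![2, 0, 3, 1] : Fin 4 → Fin 4) i = j ↔
        i = (![1, 3, 0, 2] : Fin 4 → Fin 4) j := by decide
    have hf : ∀ i : Fin 4, Finset.card {u | ((![2, 0, 3, 1] : Fin 4 → Fin 4) ∘ κ) u = i} =
        Finset.card {u | κ u = (![1, 3, 0, 2] : Fin 4 → Fin 4) i} := fun i =>
      congrArg Finset.card (Finset.filter_congr fun u _ => key (κ u) i)
    intro i
    rw [hf]
    fin_cases i
    exacts [(congrArg Nat.cast c1).trans Nat.cast_one, hq, hp,
      (congrArg Nat.cast c2).trans Nat.cast_one]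
  · intro i
    fin_cases i <;> simp <;> linarith
  · simp only [cons_val]
    linear_combination h1
  · simp only [cons_val]
    linarith

theorem IsDoubleStar.xi2_compl_eq {κ : V → Fin 4} (h : IsDoubleStar T κ) (hT : Tᶜ.Connected)
    (hV : 2 ≤ Fintype.card V) {p q : ℝ} (hp : (Finset.card {u | κ u = 0} : ℝ) = p)
    (hq : (Finset.card {u | κ u = 3} : ℝ) = q) (hp1 : 1 ≤ p) (hq1 : 1 ≤ q) :
    xi2 Tᶜ hV = sqrtSmallRoot (4 * (p + q) + 9) (16 * (p * q)) := by
  classical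
  have hpq : 1 ≤ p * q := one_le_mul_of_one_le_of_one_le hp1 hq1
  have hd := discrim_compl (k := p + q) (m := p * q) (by linarith) (by nlinarith [sq_nonneg (p - q)])
  have hS : 0 < 4 * (p + q) + 9 := by linarith
  have hD : 0 < 16 * (p * q) := by linarith
  have h1 := sqrtSmallRoot_eq hS hD hd
  have h2 := two_mul_sqrtSmallRoot_sq_lt hS hD hd
  have c1 := h.card_center (Or.inl rfl)
  have c2 := h.card_center (Or.inr rfl)
  refine eigenvalues₀_one_submatrix (m := ![p, 1, 1, q]) ?_ ?_ (h.eccMatrix_compl_eq hT)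
    (eccMatrix_isHermitian Tᶜ) hV (sqrtSmallRoot_pos hS hD) ?_ ?_
  · intro i
    fin_cases i <;> simp [hp, hq, c1, c2]
  · intro i
    fin_cases i <;> simp <;> linarith
  · simp only [cons_val]
    linear_combination h1
  · simp only [cons_val]
    linarith

/-- A tree with connected complement has a diametral pair of leaves at distance at least `3`. -/
theorem exists_diametral_leaves (hT : T.IsTree) (hTc : Tᶜ.Connected) (hV : 2 ≤ Fintype.card V) :
    ∃ u v u' v', (∀ x w, T.dist x w ≤ T.dist u v) ∧ 3 ≤ T.dist u v ∧
      T.Adj u u' ∧ (∀ w, T.Adj u w → w = u') ∧ T.Adj v v' ∧ (∀ w, T.Adj v w → w = v') := by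
  classical
  have hc := hT.connected
  have : Nontrivial V := Fintype.one_lt_card_iff_nontrivial.mp hV
  obtain ⟨⟨u, v⟩, huv⟩ := Finite.exists_max fun p : V × V => T.dist p.1 p.2
  have h : ∀ x w, T.dist x w ≤ T.dist u v := fun x w => huv (x, w)
  have hne : u ≠ v := by
    rintro rfl
    obtain ⟨x, y, hxy⟩ := exists_pair_ne V
    have h1 := hc.pos_dist_of_ne hxy
    have h2 := h x y
    rw [dist_self] at h2
    omega
  obtain ⟨v', hv', hv⟩ := exists_unique_neighbor_of_farthest hT hne (h u)
  obtain ⟨u', hu', hu⟩ := exists_unique_neighbor_of_farthest hT hne.symm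
    (fun w => by rw [T.dist_comm (u := v) (v := u)]; exact h v w)
  refine ⟨u, v, u', v', h, ?_, hu', hu, hv', hv⟩
  by_contra hlt
  -- If the diameter is at most 2, the neighbour of a diametral leaf is adjacent to everything,
  -- hence isolated in the complement.
  have hall : ∀ w, w ≠ v' → T.Adj v' w := by
    intro w hw
    by_cases hwv : w = v
    · rw [hwv]; exact hv'.symm
    · have h1 := dist_eq_of_unique_neighbor hc hv hwv
      have h2 := h v w
      have h3 := hc.pos_dist_of_ne hw.symm
      exact dist_eq_one_iff_adj.mp (by omega)
  obtain ⟨w, hw, -⟩ := exists_adj_dist_succ_eq hTc hv'.ne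
  rw [compl_adj] at hw
  exact hw.2 (hall w hw.1.symm)

theorem sqrtSmallRoot_extremal_tree (n : ℝ) :
    Real.sqrt ((13 * n - 35 - Real.sqrt (169 * n ^ 2 - 974 * n + 1417)) / 2) =
      sqrtSmallRoot (4 * (n - 2) + 9 * (n - 3)) (16 * (n - 3)) := by
  rw [sqrtSmallRoot]
  ring_nf

theorem sqrtSmallRoot_extremal_compl (n : ℝ) :
    Real.sqrt ((4 * n + 1 - Real.sqrt (16 * n ^ 2 - 56 * n + 193)) / 2) =
      sqrtSmallRoot (4 * (n - 2) + 9) (16 * (n - 3)) := by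
  rw [sqrtSmallRoot]
  ring_nf

theorem IsDoubleStar.xi2_add_xi2_compl {κ : V → Fin 4} (h : IsDoubleStar T κ) (hT : T.Connected)
    (hTc : Tᶜ.Connected) (hV : 2 ≤ Fintype.card V) {n p q : ℝ} (hn : (Fintype.card V : ℝ) = n)
    (hp : (Finset.card {u | κ u = 0} : ℝ) = p) (hq : (Finset.card {u | κ u = 3} : ℝ) = q) :
    1 ≤ p ∧ 1 ≤ q ∧ p + q = n - 2 ∧ xi2 T hV + xi2 Tᶜ hV =
      sqrtSmallRoot (4 * (n - 2) + 9 * (p * q)) (16 * (p * q)) +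
      sqrtSmallRoot (4 * (n - 2) + 9) (16 * (p * q)) := by
  have hp1 : 1 ≤ p := by rw [← hp]; exact_mod_cast h.card_pos 0
  have hq1 : 1 ≤ q := by rw [← hq]; exact_mod_cast h.card_pos 3
  have hpq : p + q = n - 2 := by
    have := h.card_eq
    rw [← hp, ← hq, ← hn, ← this]
    push_cast
    ring
  refine ⟨hp1, hq1, hpq, ?_⟩
  rw [h.xi2_eq hT hV hp hq hp1 hq1, h.xi2_compl_eq hTc hV hp hq hp1 hq1, hpq]

end Main
end EccGraph

theorem mainTheorem10 {V : Type*} [Fintype V] (T : SimpleGraph V) (n : ℕ)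
    (hcard : Fintype.card V = n) (hn : 4 ≤ n) (hT : T.IsTree) (hTc : Tᶜ.Connected) :
    Real.sqrt ((13 * (n : ℝ) - 35 - Real.sqrt (169 * (n : ℝ) ^ 2 - 974 * (n : ℝ) + 1417)) / 2)
          + Real.sqrt ((4 * (n : ℝ) + 1 - Real.sqrt (16 * (n : ℝ) ^ 2 - 56 * (n : ℝ) + 193)) / 2)
        ≤ EccGraph.xi2 T (by omega) + EccGraph.xi2 Tᶜ (by omega) ∧
      (EccGraph.xi2 T (by omega) + EccGraph.xi2 Tᶜ (by omega) =
          Real.sqrt ((13 * (n : ℝ) - 35 - Real.sqrt (169 * (n : ℝ) ^ 2 - 974 * (n : ℝ) + 1417)) / 2)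
          + Real.sqrt ((4 * (n : ℝ) + 1 - Real.sqrt (16 * (n : ℝ) ^ 2 - 56 * (n : ℝ) + 193)) / 2) ↔
        Nonempty (T ≃g EccGraph.treeT3 0 (n - 4))) := by
  have hV : 2 ≤ Fintype.card V := by omega
  have hn4 : (4 : ℝ) ≤ n := by exact_mod_cast hn
  have hcardR : (Fintype.card V : ℝ) = n := by rw [hcard]
  rw [EccGraph.sqrtSmallRoot_extremal_tree, EccGraph.sqrtSmallRoot_extremal_compl]
  have hiso : Nonempty (T ≃g EccGraph.treeT3 0 (n - 4)) →
      EccGraph.xi2 T hV + EccGraph.xi2 Tᶜ hV =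
        EccGraph.sqrtSmallRoot (4 * ((n : ℝ) - 2) + 9 * (n - 3)) (16 * (n - 3)) +
        EccGraph.sqrtSmallRoot (4 * ((n : ℝ) - 2) + 9) (16 * (n - 3)) := by
    rintro ⟨e⟩
    have h := (EccGraph.treeT3_isDoubleStar 0 (n - 4)).comp_iso e
    have h0 : Finset.card {u | (EccGraph.treeT3Cell 0 (n - 4) ∘ e) u = 0} = 1 := by
      rw [← EccGraph.treeT3Cell_card_zero (n - 4)]
      exact Finset.card_equiv e.toEquiv (by simp)
    obtain ⟨-, -, hpq, hxi⟩ := h.xi2_add_xi2_compl hT.connected hTc hV hcardR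
      (by rw [h0, Nat.cast_one]) rfl
    rw [hxi, one_mul, show ((Finset.card {u | (EccGraph.treeT3Cell 0 (n - 4) ∘ e) u = 3} : ℕ) : ℝ)
      = n - 3 by linarith]
  -- Since the extremal tree attains the bound, inequality and equality case both follow once every
  -- other tree is strictly above it.
  suffices hmain : Nonempty (T ≃g EccGraph.treeT3 0 (n - 4)) ∨
      EccGraph.sqrtSmallRoot (4 * ((n : ℝ) - 2) + 9 * (n - 3)) (16 * (n - 3)) +
        EccGraph.sqrtSmallRoot (4 * ((n : ℝ) - 2) + 9) (16 * (n - 3)) <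
      EccGraph.xi2 T hV + EccGraph.xi2 Tᶜ hV by
    rcases hmain with h | h
    · exact ⟨(hiso h).ge, fun _ => h, fun _ => hiso h⟩
    · exact ⟨h.le, fun h' => absurd h' h.ne', hiso⟩
  obtain ⟨u, v, u', v', h, hd, hu', hu, hv', hv⟩ := EccGraph.exists_diametral_leaves hT hTc hV
  rcases hd.eq_or_lt with hd | hd
  · obtain ⟨κ, hκ⟩ := EccGraph.exists_isDoubleStar_of_diam_eq_three hT h hd.symm hu' hu hv' hv
    by_cases h0 : Finset.card {u | κ u = 0} = 1
    · left
      have := hκ.nonempty_iso_treeT3 h0 (by omega)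
      rwa [hcard] at this
    by_cases h3 : Finset.card {u | κ u = 3} = 1
    · left
      have key : ∀ i : Fin 4, i.rev = 0 ↔ i = 3 := by decide
      have := hκ.rev.nonempty_iso_treeT3 (by simpa only [Function.comp_apply, key]) (by omega)
      rwa [hcard] at this
    right
    obtain ⟨-, -, hpq, hxi⟩ := hκ.xi2_add_xi2_compl hT.connected hTc hV hcardR rfl rfl
    have hp2 : (2 : ℝ) ≤ (Finset.card {u | κ u = 0} : ℕ) := by
      have := hκ.card_pos 0
      exact_mod_cast (by omega : 2 ≤ Finset.card {u | κ u = 0})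
    have hq2 : (2 : ℝ) ≤ (Finset.card {u | κ u = 3} : ℕ) := by
      have := hκ.card_pos 3
      exact_mod_cast (by omega : 2 ≤ Finset.card {u | κ u = 3})
    rw [hxi]
    generalize ((Finset.card {u | κ u = 0} : ℕ) : ℝ) = p at hpq hp2 ⊢
    generalize ((Finset.card {u | κ u = 3} : ℕ) : ℝ) = q at hpq hq2 ⊢
    -- This is `(p - 1)(q - 1) > 0` combined with `p + q = n - 2`.
    have hlt : (n : ℝ) - 3 < p * q := by nlinarith
    have hk : (2 : ℝ) ≤ n - 2 := by linarith
    have hm : (1 : ℝ) ≤ n - 3 := by linarith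
    refine add_lt_add (EccGraph.sqrtSmallRoot_tree_lt_of_lt hk hm hlt)
      (EccGraph.sqrtSmallRoot_compl_lt_of_lt hk hm hlt ?_)
    rw [← hpq]
    nlinarith [sq_nonneg (p - q)]
  · right
    have h1 := EccGraph.xi2_ge_of_four_le_diam hT hV h hd hu' hu hv' hv
    have h2 := EccGraph.xi2_compl_ge_of_four_le_diam hT hTc hV hd hu' hu hv' hv
    have h3 := EccGraph.sqrtSmallRoot_tree_lt (k := (n : ℝ) - 2) (m := n - 3) (by linarith)
      (by linarith)
    have h4 := EccGraph.sqrtSmallRoot_compl_lt (k := (n : ℝ) - 2) (m := n - 3) (by linarith)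
      (by linarith) (by nlinarith [sq_nonneg ((n : ℝ) - 4)]) (by linarith)
    linarith
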